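/- Let $n\ge 2$. A matrix $A\in\mathbb R^{n\times n}$ is called totally nonnegative (TN) if all its minors are nonnegative, totally positive (TP) if all its minors are positive, and oscillatory if it is TN and $A^k$ is TP for some integer $k\ge 1$; the exponent $r(A)$ of an oscillatory matrix $A$ is the least integer $k\ge1$ such that $A^k$ is TP. For $1\le c\le n$, the lower-left corner minor of size $c$ of a matrix is the minor with the last $c$ rows and the first $c$ columns, and the upper-right corner minor of size $c$ is the minor with the first $c$ rows and the last $c$ columns. For $M\in\mathbb R^{n\times n}$ let $r_\ell(M)$ (respectively $r_u(M)$) denote the least integer $w\ge 1$ such that all lower-left (respectively upper-right) corner minors of $M^w$ of sizes $1,\dots,n-1$ (that is, all except perhaps the determinant) are positive. For $q\in\mathbb R$ and $i\in\{2,\dots,n\}$ let $L_i(q)=I+qE_{i,i-1}$, where $E_{i,i-1}$ is the $n\times n$ matrix whose only nonzero entry is a $1$ in position $(i,i-1)$, and let $U_i(q)=L_i(q)^T$. For $i\in\{2,\dots,n\}$ and $v\in\mathbb R^{n-i+1}$ let $$W_i(v)=L_n(v_1)L_{n-1}(v_2)\cdots L_i(v_{n-i+1}),\qquad Q_i(v)=U_i(v_1)U_{i+1}(v_2)\cdots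 U_n(v_{n-i+1}).$$ Theorem. Let $A\in\mathbb R^{n\times n}$ be oscillatory, with successive elementary bidiagonal (SEB) factorization $$A=W_2(\ell^2)\cdots W_n(\ell^n)\,D\,Q_n(u^n)\cdots Q_2(u^2),$$ where $\ell^i,u^i\in\mathbb R^{n-i+1}$ have nonnegative entries for $i=2,\dots,n$ and $D$ is a diagonal matrix with positive diagonal entries. Then $r_\ell\big(W_2(\ell^2)\cdots W_n(\ell^n)\big)$ and $r_u\big(Q_n(u^n)\cdots Q_2(u^2)\big)$ are well defined (such integers $w$ exist), and $$r(A)=\max\big\{\,r_\ell\big(W_2(\ell^2)\cdots W_n(\ell^n)\big),\ r_u\big(Q_n(u^n)\cdots Q_2(u^2)\big)\big\}.$$ -/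

import Mathlib

namespace OscMat

/-- A square real matrix is totally nonnegative (TN) if all its minors are nonnegative.
Row and column index sets of size `p` are given by their increasing enumerations
(for `p = 0` the minor is `1`, so that case imposes nothing). -/
def IsTN {n : ℕ} (A : Matrix (Fin n) (Fin n) ℝ) : Prop :=
  ∀ (p : ℕ) (α β : Fin p ↪o Fin n), 0 ≤ (A.submatrix α β).det

/-- A square real matrix is totally positive (TP) if all its minors are positive. -/
def IsTP {n : ℕ} (A : Matrix (Fin n) (Fin n) ℝ) : Prop :=
  ∀ (p : ℕ) (α β : Fin p ↪o Fin n), 0 < (A.submatrix α β).det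

/-- `A` is oscillatory if it is TN and some positive power of it is TP. -/
def IsOscillatory {n : ℕ} (A : Matrix (Fin n) (Fin n) ℝ) : Prop :=
  IsTN A ∧ ∃ k : ℕ, 0 < k ∧ IsTP (A ^ k)

/-- The first `c` indices of `{0, …, n - 1}`. -/
def firstIdx {n : ℕ} (c : ℕ) (hc : c ≤ n) (i : Fin c) : Fin n :=
  ⟨i, lt_of_lt_of_le i.isLt hc⟩

/-- The last `c` indices of `{0, …, n - 1}`. -/
def lastIdx {n : ℕ} (c : ℕ) (hc : c ≤ n) (i : Fin c) : Fin n :=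
  ⟨n - c + i, by have := i.isLt; omega⟩

/-- The lower-left corner minor of size `c`: last `c` rows, first `c` columns. -/
def lowerLeftMinor {n : ℕ} (A : Matrix (Fin n) (Fin n) ℝ) (c : ℕ) (hc : c ≤ n) : ℝ :=
  (A.submatrix (lastIdx c hc) (firstIdx c hc)).det

/-- The upper-right corner minor of size `c`: first `c` rows, last `c` columns. -/
def upperRightMinor {n : ℕ} (A : Matrix (Fin n) (Fin n) ℝ) (c : ℕ) (hc : c ≤ n) : ℝ :=
  (A.submatrix (firstIdx c hc) (lastIdx c hc)).det

/-- The positive integers `k` such that `A ^ k` is TP. -/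
def tpPowers {n : ℕ} (A : Matrix (Fin n) (Fin n) ℝ) : Set ℕ :=
  {k | 0 < k ∧ IsTP (A ^ k)}

/-- The positive integers `w` such that all lower-left corner minors of `A ^ w`, except
perhaps for its determinant, are positive. -/
def lowerPowers {n : ℕ} (A : Matrix (Fin n) (Fin n) ℝ) : Set ℕ :=
  {w | 0 < w ∧ ∀ (c : ℕ) (hc : c < n), 0 < c → 0 < lowerLeftMinor (A ^ w) c hc.le}

/-- The positive integers `v` such that all upper-right corner minors of `A ^ v`, except
perhaps for its determinant, are positive. -/
def upperPowers {n : ℕ} (A : Matrix (Fin n) (Fin n) ℝ) : Set ℕ :=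
  {v | 0 < v ∧ ∀ (c : ℕ) (hc : c < n), 0 < c → 0 < upperRightMinor (A ^ v) c hc.le}

/-- The exponent `r(A)`: the least positive `k` with `A ^ k` TP. -/
noncomputable def exponent {n : ℕ} (A : Matrix (Fin n) (Fin n) ℝ) : ℕ :=
  sInf (tpPowers A)

/-- `r_ℓ(A)`: the least element of `lowerPowers A`. -/
noncomputable def lowerExponent {n : ℕ} (A : Matrix (Fin n) (Fin n) ℝ) : ℕ :=
  sInf (lowerPowers A)

/-- `r_u(A)`: the least element of `upperPowers A`. -/
noncomputable def upperExponent {n : ℕ} (A : Matrix (Fin n) (Fin n) ℝ) : ℕ :=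
  sInf (upperPowers A)

/-- The elementary bidiagonal matrix `L_i(q) = I + q E_{i,i-1}` of size `n`, where
`i ∈ {2, …, n}` counts rows from one (the row `a : Fin n` is row number `a + 1`). -/
def elemL (n i : ℕ) (q : ℝ) : Matrix (Fin n) (Fin n) ℝ :=
  1 + Matrix.of fun a b : Fin n => if (a : ℕ) + 1 = i ∧ (b : ℕ) + 2 = i then q else 0

/-- The elementary bidiagonal matrix `U_i(q)`, the transpose of `L_i(q)`. -/
def elemU (n i : ℕ) (q : ℝ) : Matrix (Fin n) (Fin n) ℝ :=
  (elemL n i q).transpose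

/-- `W_i(v) = L_n(v_1) L_{n-1}(v_2) ⋯ L_i(v_{n-i+1})`. -/
def matW (n i : ℕ) (v : ℕ → ℝ) : Matrix (Fin n) (Fin n) ℝ :=
  ((List.range' i (n + 1 - i)).reverse.map fun j => elemL n j (v (n - j + 1))).prod

/-- `Q_i(v) = U_i(v_1) U_{i+1}(v_2) ⋯ U_n(v_{n-i+1})`. -/
def matQ (n i : ℕ) (v : ℕ → ℝ) : Matrix (Fin n) (Fin n) ℝ :=
  ((List.range' i (n + 1 - i)).map fun j => elemU n j (v (j - i + 1))).prod

/-- The lower factor `W_2(ℓ^2) W_3(ℓ^3) ⋯ W_n(ℓ^n)`. -/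
def lowerFactor (n : ℕ) (l : ℕ → ℕ → ℝ) : Matrix (Fin n) (Fin n) ℝ :=
  ((List.range' 2 (n - 1)).map fun i => matW n i (l i)).prod

/-- The upper factor `Q_n(u^n) ⋯ Q_3(u^3) Q_2(u^2)`. -/
def upperFactor (n : ℕ) (u : ℕ → ℕ → ℝ) : Matrix (Fin n) (Fin n) ℝ :=
  ((List.range' 2 (n - 1)).reverse.map fun i => matQ n i (u i)).prod

/-- `A = W_2(ℓ^2) ⋯ W_n(ℓ^n) D Q_n(u^n) ⋯ Q_2(u^2)` is the successive elementary bidiagonal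
factorization of `A`: the multipliers `l i j`, `u i j` (`2 ≤ i ≤ n`, `1 ≤ j ≤ n - i + 1`; the
values at other indices are not used) are nonnegative, and `D = diag d` has positive
diagonal entries. -/
structure IsSEBFactorization {n : ℕ} (A : Matrix (Fin n) (Fin n) ℝ)
    (l : ℕ → ℕ → ℝ) (d : Fin n → ℝ) (u : ℕ → ℕ → ℝ) : Prop where
  l_nonneg : ∀ i j : ℕ, 2 ≤ i → 1 ≤ j → i + j ≤ n + 1 → 0 ≤ l i j
  u_nonneg : ∀ i j : ℕ, 2 ≤ i → 1 ≤ j → i + j ≤ n + 1 → 0 ≤ u i j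
  d_pos : ∀ a : Fin n, 0 < d a
  eq_prod : A = lowerFactor n l * Matrix.diagonal d * upperFactor n u

end OscMat

namespace OscMat

open Matrix

variable {n p : ℕ}

/-! Only the pattern of positive minors matters. Read "minor `S`, `T` positive" as a transition from
`S` to `T`; by Cauchy–Binet, transitions of a product of TN matrices are composites
(`IsTN.minor_mul_pos`). A factor `L_i(q)` moves at most one index one step down, so its transitions
are closed under componentwise min and max and contain every `S → S`. These properties survive
products and transposes, hence hold for the powers of `A` (`IsNetwork`). In such a lattice the two
corner transitions of each size generate all others (`IsNetwork.isTP`), so TP powers are those with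
positive corners of both kinds. When descending, the diagonal does nothing and the upper factor can
only raise indices or leave them fixed; hence lower corners of `A ^ w` depend only on the lower
factor (`lowerPowers_ldu`), and dually. Both sets of powers are upward closed, so the least common
element is the maximum of the least elements. -/

/-- The minor of `M` with rows `S` and columns `T`. -/
def minor (M : Matrix (Fin n) (Fin n) ℝ) (S T : Fin p ↪o Fin n) : ℝ :=
  (M.submatrix S T).det

lemma minor_transpose (M : Matrix (Fin n) (Fin n) ℝ) (S T : Fin p ↪o Fin n) :
    minor Mᵀ S T = minor M T S := by
  rw [minor, ← transpose_submatrix, det_transpose, minor]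

/-! ### Cauchy–Binet and products of TN matrices. -/

lemma exists_orderEmbedding_perm_of_injective (f : Fin p → Fin n) (hf : Function.Injective f) :
    ∃ (e : Fin p ↪o Fin n) (σ : Equiv.Perm (Fin p)), (fun i => e (σ i)) = f := by
  refine ⟨OrderEmbedding.ofStrictMono (f ∘ Tuple.sort f)
    ((Tuple.monotone_sort f).strictMono_of_injective (hf.comp (Tuple.sort f).injective)),
    (Tuple.sort f)⁻¹, ?_⟩
  funext i
  simp

lemma injective_orderEmbedding_perm :
    Function.Injective fun (x : (Fin p ↪o Fin n) × Equiv.Perm (Fin p)) (i : Fin p) =>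
      x.1 (x.2 i) := by
  rintro ⟨e, σ⟩ ⟨e', σ'⟩ h
  have hr : Set.range e = Set.range e' := by
    have := congrArg Set.range h
    have h1 : Set.range (fun i => e (σ i)) = Set.range e := σ.surjective.range_comp e
    have h2 : Set.range (fun i => e' (σ' i)) = Set.range e' := σ'.surjective.range_comp e'
    rw [← h1, ← h2]
    exact this
  have he : e = e' := DFunLike.coe_injective
    ((e.strictMono.range_inj e'.strictMono).1 hr)
  subst he
  refine Prod.ext rfl (Equiv.ext fun i => e.injective (congrFun h i))

/-- **Cauchy–Binet formula.** -/
theorem det_mul_eq_sum_minors (A : Matrix (Fin p) (Fin n) ℝ) (B : Matrix (Fin n) (Fin p) ℝ) :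
    (A * B).det = ∑ e : Fin p ↪o Fin n, (A.submatrix id e).det * (B.submatrix e id).det := by
  classical
  have h1 : (A * B).det = ∑ f : Fin p → Fin n, (∏ i, A i (f i)) * (B.submatrix f id).det := by
    have hrow : A * B = fun i => ∑ k, A i k • B k := by
      ext i j
      simp [Matrix.mul_apply]
    have := (detRowAlternating (R := ℝ) (n := Fin p)).toMultilinearMap.map_sum
      (fun (i : Fin p) (k : Fin n) => A i k • B k)
    rw [hrow]
    refine this.trans (Finset.sum_congr rfl fun f _ => ?_)
    exact (detRowAlternating (R := ℝ) (n := Fin p)).toMultilinearMap.map_smul_univ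
      (fun i => A i (f i)) (fun i => B (f i))
  rw [h1]
  -- Injective choices of rows factor uniquely as `e ∘ σ`; the others repeat a row and contribute
  -- zero.
  rw [← Fintype.sum_of_injective (fun (x : (Fin p ↪o Fin n) × Equiv.Perm (Fin p)) (i : Fin p) =>
      x.1 (x.2 i)) injective_orderEmbedding_perm
      (fun x => (∏ i, A i (x.1 (x.2 i))) * (B.submatrix (fun i => x.1 (x.2 i)) id).det) _ ?_
      (fun _ => rfl)]
  · rw [Fintype.sum_prod_type]
    refine Finset.sum_congr rfl fun e _ => ?_
    have h2 : ∀ σ : Equiv.Perm (Fin p), (B.submatrix (fun i => e (σ i)) id).det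
        = (Equiv.Perm.sign σ : ℝ) * (B.submatrix e id).det := fun σ =>
      det_permute σ (B.submatrix e id)
    simp only [h2]
    rw [← det_transpose (A.submatrix id e), det_apply' (A.submatrix id e)ᵀ, Finset.sum_mul]
    refine Finset.sum_congr rfl fun σ _ => ?_
    simp only [transpose_apply, submatrix_apply, id]
    ring
  · intro f hf
    have : ¬ Function.Injective f := fun hi => hf <| by
      obtain ⟨e, σ, h⟩ := exists_orderEmbedding_perm_of_injective f hi
      exact ⟨(e, σ), h⟩
    simp only [Function.Injective, not_forall] at this
    obtain ⟨i, j, hij, hne⟩ := this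
    rw [det_zero_of_row_eq hne (by ext k; simp [hij]), mul_zero]

lemma minor_mul (M N : Matrix (Fin n) (Fin n) ℝ) (S T : Fin p ↪o Fin n) :
    minor (M * N) S T = ∑ U : Fin p ↪o Fin n, minor M S U * minor N U T := by
  have : (M * N).submatrix S T = M.submatrix S id * N.submatrix id T := by
    ext i j
    simp [Matrix.mul_apply]
  rw [minor, this, det_mul_eq_sum_minors]
  rfl

lemma IsTN.mul {M N : Matrix (Fin n) (Fin n) ℝ} (hM : IsTN M) (hN : IsTN N) : IsTN (M * N) := by
  intro p S T
  change 0 ≤ minor (M * N) S T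
  rw [minor_mul]
  exact Finset.sum_nonneg fun U _ => mul_nonneg (hM p S U) (hN p U T)

/-- Positive minors of a product of TN matrices are concatenations of positive minors. -/
lemma IsTN.minor_mul_pos {M N : Matrix (Fin n) (Fin n) ℝ} (hM : IsTN M) (hN : IsTN N)
    {S T : Fin p ↪o Fin n} :
    0 < minor (M * N) S T ↔ ∃ U : Fin p ↪o Fin n, 0 < minor M S U ∧ 0 < minor N U T := by
  have hnn : ∀ U ∈ Finset.univ, 0 ≤ minor M S U * minor N U T := fun U _ =>
    mul_nonneg (hM p S U) (hN p U T)
  rw [minor_mul, Finset.sum_pos_iff_of_nonneg hnn]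
  refine ⟨fun ⟨U, _, h⟩ => ⟨U, ?_⟩, fun ⟨U, h1, h2⟩ => ⟨U, Finset.mem_univ _, mul_pos h1 h2⟩⟩
  exact ⟨pos_of_mul_pos_left h (hN p U T), pos_of_mul_pos_right h (hM p S U)⟩

/-! ### Minors of diagonal and elementary bidiagonal matrices. -/

lemma det_one_submatrix {f : Fin p → Fin n} (hf : StrictMono f) (T : Fin p ↪o Fin n) :
    ((1 : Matrix (Fin n) (Fin n) ℝ).submatrix f T).det = if f = T then 1 else 0 := by
  split_ifs with h
  · rw [h, submatrix_one _ T.injective, det_one]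
  · by_cases hr : ∀ j, f j ∈ Set.range T
    · refine absurd ((hf.range_inj T.strictMono).1 ?_) h
      have hsub : Finset.univ.image f ⊆ Finset.univ.image T := by
        intro x hx
        obtain ⟨j, -, rfl⟩ := Finset.mem_image.1 hx
        obtain ⟨k, hk⟩ := hr j
        exact Finset.mem_image.2 ⟨k, Finset.mem_univ _, hk⟩
      have := Finset.eq_of_subset_of_card_le hsub (by
        rw [Finset.card_image_of_injective _ T.injective, Finset.card_image_of_injective _ hf.injective])
      simpa using congrArg (fun s : Finset (Fin n) => (s : Set (Fin n))) this
    · push Not at hr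
      obtain ⟨j, hj⟩ := hr
      refine det_eq_zero_of_row_eq_zero j fun k => ?_
      exact one_apply_ne fun h' => hj ⟨k, h'.symm⟩

lemma minor_one (S T : Fin p ↪o Fin n) : minor 1 S T = if S = T then 1 else 0 := by
  rw [minor, det_one_submatrix S.strictMono]
  simp only [DFunLike.coe_fn_eq]

lemma minor_diagonal (d : Fin n → ℝ) (S T : Fin p ↪o Fin n) :
    minor (diagonal d) S T = if S = T then ∏ j, d (S j) else 0 := by
  have : (diagonal d).submatrix S T
      = diagonal (fun j => d (S j)) * (1 : Matrix (Fin n) (Fin n) ℝ).submatrix S T := by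
    ext i j
    simp [diagonal_mul, diagonal_apply, one_apply]
  rw [minor, this, det_mul, det_diagonal, det_one_submatrix S.strictMono]
  simp only [DFunLike.coe_fn_eq, mul_ite, mul_one, mul_zero]

lemma elemL_submatrix_of_notMem {i : ℕ} (q : ℝ) (S T : Fin p ↪o Fin n)
    (h : ∀ j, (S j : ℕ) + 1 ≠ i) :
    (elemL n i q).submatrix S T = (1 : Matrix (Fin n) (Fin n) ℝ).submatrix S T := by
  ext a b
  simp [elemL, h a]

/-- Linearity in row `j`, which is the only row differing from the identity. -/
lemma minor_elemL_of_eq {i : ℕ} (q : ℝ) (S T : Fin p ↪o Fin n) (j : Fin p) (b : Fin n)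
    (hj : (S j : ℕ) + 1 = i) (hb : (b : ℕ) + 2 = i) :
    minor (elemL n i q) S T = minor 1 S T +
      q * ((1 : Matrix (Fin n) (Fin n) ℝ).submatrix (Function.update S j b) T).det := by
  have h1 : (elemL n i q).submatrix S T =
      ((1 : Matrix (Fin n) (Fin n) ℝ).submatrix S T).updateRow j
        ((fun k => (1 : Matrix (Fin n) (Fin n) ℝ) (S j) (T k)) +
          q • fun k => (1 : Matrix (Fin n) (Fin n) ℝ) b (T k)) := by
    ext a k
    by_cases ha : a = j
    · subst ha
      have : ((T k : ℕ) + 2 = i) ↔ b = T k := by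
        rw [Fin.ext_iff]
        omega
      simp [elemL, hj, this, one_apply]
    · have : (S a : ℕ) + 1 ≠ i := fun h => ha (S.injective (Fin.ext (by omega)))
      simp [elemL, this, ha]
  have h2 : ((1 : Matrix (Fin n) (Fin n) ℝ).submatrix S T).updateRow j
        (fun k => (1 : Matrix (Fin n) (Fin n) ℝ) (S j) (T k)) =
      (1 : Matrix (Fin n) (Fin n) ℝ).submatrix S T := updateRow_eq_self _ _
  have h3 : ((1 : Matrix (Fin n) (Fin n) ℝ).submatrix S T).updateRow j
        (fun k => (1 : Matrix (Fin n) (Fin n) ℝ) b (T k)) =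
      (1 : Matrix (Fin n) (Fin n) ℝ).submatrix (Function.update S j b) T := by
    ext a k
    by_cases ha : a = j
    · subst ha
      simp only [updateRow_self, submatrix_apply]
      rw [Function.update_self]
    · simp only [updateRow_ne ha, submatrix_apply]
      rw [Function.update_of_ne ha]
  rw [minor, h1, det_updateRow_add, det_updateRow_smul, h2, h3, minor]

/-- The moves of an elementary bidiagonal matrix: at most the index `i` moves to `i - 1`. -/
lemma minor_elemL {i : ℕ} (hi : 2 ≤ i) {q : ℝ} (hq : 0 ≤ q) (S T : Fin p ↪o Fin n) :
    0 ≤ minor (elemL n i q) S T ∧ (0 < minor (elemL n i q) S T ↔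
      ∀ j, T j = S j ∨ (0 < q ∧ (S j : ℕ) + 1 = i ∧ (T j : ℕ) + 2 = i)) := by
  by_cases h : ∃ j, (S j : ℕ) + 1 = i
  · obtain ⟨j, hj⟩ := h
    obtain ⟨b, hb⟩ : ∃ b : Fin n, (b : ℕ) + 2 = i :=
      ⟨⟨i - 2, by have := (S j).isLt; omega⟩, by simp only; omega⟩
    have huniq : ∀ k, (S k : ℕ) + 1 = i → k = j := fun k hk =>
      S.injective (Fin.ext (by omega))
    rw [minor_elemL_of_eq q S T j b hj hb, minor_one]
    -- If `b` is already occupied, the move is blocked: the second determinant has a repeated row,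
    -- and the combinatorial move would violate injectivity of `T`.
    by_cases hS : ∃ k, S k = b
    · obtain ⟨k, hk⟩ := hS
      have hkj : k ≠ j := by
        rintro rfl
        rw [hk] at hj
        omega
      rw [det_zero_of_row_eq hkj (by
        ext a
        simp only [submatrix_apply]
        rw [Function.update_self, Function.update_of_ne hkj, hk]), mul_zero, add_zero]
      refine ⟨by split_ifs <;> norm_num, ?_⟩
      have : (0 : ℝ) < (if S = T then 1 else 0) ↔ S = T := by split_ifs with h <;> simp [h]
      rw [this]
      refine ⟨fun h a => Or.inl (by rw [h]), fun h => ?_⟩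
      refine DFunLike.ext _ _ fun a => ?_
      rcases h a with h' | ⟨-, h1, h2⟩
      · exact h'.symm
      · exfalso
        obtain rfl := huniq a h1
        rcases h k with h3 | ⟨-, h3, -⟩
        · refine hkj (T.injective (Fin.ext ?_))
          rw [h3, hk]
          omega
        · exact hkj (huniq k h3)
    -- As `b` is free and directly below `S j`, replacing `S j` by `b` preserves the order.
    · have hmono : StrictMono (Function.update S j b) := by
        intro x y hxy
        have hlt := S.strictMono hxy
        have hx : S x ≠ b := fun h => hS ⟨x, h⟩
        rw [Fin.lt_def] at hlt ⊢
        rw [Ne, Fin.ext_iff] at hx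
        by_cases hxj : x = j
        · subst hxj
          rw [Function.update_self, Function.update_of_ne hxy.ne']
          omega
        · by_cases hyj : y = j
          · subst hyj
            rw [Function.update_self, Function.update_of_ne hxj]
            omega
          · rwa [Function.update_of_ne hxj, Function.update_of_ne hyj]
      rw [det_one_submatrix hmono]
      refine ⟨by split_ifs <;> positivity, ?_⟩
      constructor
      · intro h a
        by_cases hST : S = T
        · exact Or.inl (by rw [hST])
        · by_cases hU : Function.update (⇑S) j b = T
          · rw [if_neg hST, if_pos hU, zero_add, mul_one] at h
            rw [← hU]
            by_cases ha : a = j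
            · subst ha
              right
              rw [Function.update_self]
              exact ⟨h, hj, hb⟩
            · left
              rw [Function.update_of_ne ha]
          · simp [hST, hU] at h
      · intro h
        rcases h j with h1 | ⟨h0, -, h2⟩
        · have : S = T := by
            refine DFunLike.ext _ _ fun a => ?_
            rcases h a with h' | ⟨-, h3, h4⟩
            · exact h'.symm
            · rw [huniq a h3, h1]
          rw [if_pos this]
          split_ifs <;> positivity
        · have : Function.update (⇑S) j b = T := by
            funext a
            by_cases ha : a = j
            · subst ha
              rw [Function.update_self]
              exact Fin.ext (by omega)
            · rw [Function.update_of_ne ha]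
              rcases h a with h' | ⟨-, h3, h4⟩
              · exact h'.symm
              · exact absurd (huniq a h3) ha
          rw [if_pos this]
          split_ifs <;> positivity
  · push Not at h
    have : minor (elemL n i q) S T = minor 1 S T := by
      rw [minor, elemL_submatrix_of_notMem q S T h, minor]
    rw [this, minor_one]
    have h0 : (0 : ℝ) < (if S = T then 1 else 0) ↔ S = T := by split_ifs with h <;> simp [h]
    rw [h0]
    refine ⟨by split_ifs <;> norm_num, fun h' a => Or.inl (by rw [h']), fun h' => ?_⟩
    refine DFunLike.ext _ _ fun a => ?_
    rcases h' a with h' | ⟨-, h3, -⟩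
    · exact h'.symm
    · exact absurd h3 (h a)

/-! ### Lattice structure of positive minors. -/

/-- The componentwise minimum of two increasing enumerations. -/
def embInf (S T : Fin p ↪o Fin n) : Fin p ↪o Fin n :=
  OrderEmbedding.ofStrictMono (fun j => S j ⊓ T j) fun _ _ h =>
    lt_min (min_lt_of_left_lt (S.strictMono h)) (min_lt_of_right_lt (T.strictMono h))

/-- The componentwise maximum of two increasing enumerations. -/
def embSup (S T : Fin p ↪o Fin n) : Fin p ↪o Fin n :=
  OrderEmbedding.ofStrictMono (fun j => S j ⊔ T j) fun _ _ h =>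
    max_lt (lt_max_of_lt_left (S.strictMono h)) (lt_max_of_lt_right (T.strictMono h))

@[simp] lemma embInf_apply (S T : Fin p ↪o Fin n) (j : Fin p) : embInf S T j = S j ⊓ T j := rfl

@[simp] lemma embSup_apply (S T : Fin p ↪o Fin n) (j : Fin p) : embSup S T j = S j ⊔ T j := rfl

lemma embInf_eq_left {S T : Fin p ↪o Fin n} (h : ∀ j, S j ≤ T j) : embInf S T = S :=
  DFunLike.ext _ _ fun j => inf_eq_left.2 (h j)

lemma embInf_eq_right {S T : Fin p ↪o Fin n} (h : ∀ j, T j ≤ S j) : embInf S T = T :=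
  DFunLike.ext _ _ fun j => inf_eq_right.2 (h j)

lemma embSup_eq_left {S T : Fin p ↪o Fin n} (h : ∀ j, T j ≤ S j) : embSup S T = S :=
  DFunLike.ext _ _ fun j => sup_eq_left.2 (h j)

lemma embSup_eq_right {S T : Fin p ↪o Fin n} (h : ∀ j, S j ≤ T j) : embSup S T = T :=
  DFunLike.ext _ _ fun j => sup_eq_right.2 (h j)

/-- TN matrices with positive principal minors whose positive minors form a sublattice of
pairs of index sets, as is the case for weight matrices of planar networks. -/
structure IsNetwork (M : Matrix (Fin n) (Fin n) ℝ) : Prop where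
  tn : IsTN M
  principal : ∀ {p : ℕ} (S : Fin p ↪o Fin n), 0 < minor M S S
  inf : ∀ {p : ℕ} {S T S' T' : Fin p ↪o Fin n}, 0 < minor M S T → 0 < minor M S' T' →
    0 < minor M (embInf S S') (embInf T T')
  sup : ∀ {p : ℕ} {S T S' T' : Fin p ↪o Fin n}, 0 < minor M S T → 0 < minor M S' T' →
    0 < minor M (embSup S S') (embSup T T')

lemma IsNetwork.mul {M N : Matrix (Fin n) (Fin n) ℝ} (hM : IsNetwork M) (hN : IsNetwork N) :
    IsNetwork (M * N) where
  tn := hM.tn.mul hN.tn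
  principal S := (hM.tn.minor_mul_pos hN.tn).2 ⟨S, hM.principal S, hN.principal S⟩
  inf h h' := by
    obtain ⟨U, h1, h2⟩ := (hM.tn.minor_mul_pos hN.tn).1 h
    obtain ⟨U', h1', h2'⟩ := (hM.tn.minor_mul_pos hN.tn).1 h'
    exact (hM.tn.minor_mul_pos hN.tn).2 ⟨embInf U U', hM.inf h1 h1', hN.inf h2 h2'⟩
  sup h h' := by
    obtain ⟨U, h1, h2⟩ := (hM.tn.minor_mul_pos hN.tn).1 h
    obtain ⟨U', h1', h2'⟩ := (hM.tn.minor_mul_pos hN.tn).1 h'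
    exact (hM.tn.minor_mul_pos hN.tn).2 ⟨embSup U U', hM.sup h1 h1', hN.sup h2 h2'⟩

lemma IsNetwork.transpose {M : Matrix (Fin n) (Fin n) ℝ} (hM : IsNetwork M) : IsNetwork Mᵀ where
  tn p S T := (hM.tn p T S).trans_eq (minor_transpose M S T).symm
  principal S := by
    rw [minor_transpose]
    exact hM.principal S
  inf := by
    simp only [minor_transpose]
    exact hM.inf
  sup := by
    simp only [minor_transpose]
    exact hM.sup

lemma minor_diagonal_pos_iff {d : Fin n → ℝ} (hd : ∀ a, 0 < d a) (S T : Fin p ↪o Fin n) :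
    0 < minor (diagonal d) S T ↔ S = T := by
  rw [minor_diagonal]
  split_ifs with h
  · exact iff_of_true (Finset.prod_pos fun j _ => hd _) h
  · exact iff_of_false (lt_irrefl _) h

lemma isNetwork_diagonal {d : Fin n → ℝ} (hd : ∀ a, 0 < d a) : IsNetwork (diagonal d) where
  tn p S T := by
    change 0 ≤ minor (diagonal d) S T
    rw [minor_diagonal]
    split_ifs
    · exact Finset.prod_nonneg fun j _ => (hd _).le
    · exact le_rfl
  principal S := (minor_diagonal_pos_iff hd S S).2 rfl
  inf := by
    simp only [minor_diagonal_pos_iff hd]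
    rintro p S T S' T' rfl rfl
    rfl
  sup := by
    simp only [minor_diagonal_pos_iff hd]
    rintro p S T S' T' rfl rfl
    rfl

lemma isNetwork_one : IsNetwork (1 : Matrix (Fin n) (Fin n) ℝ) := by
  rw [← diagonal_one]
  exact isNetwork_diagonal fun _ => one_pos

/-- Positivity is tested index by index, and the diagonal together with one pair of adjacent indices
is a sublattice, since nothing lies strictly between them. -/
lemma isNetwork_elemL {i : ℕ} (hi : 2 ≤ i) {q : ℝ} (hq : 0 ≤ q) : IsNetwork (elemL n i q) where
  tn p S T := (minor_elemL hi hq S T).1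
  principal S := (minor_elemL hi hq S S).2.2 fun _ => Or.inl rfl
  inf {p S T S' T'} h h' := by
    rw [(minor_elemL hi hq _ _).2] at h h' ⊢
    intro j
    specialize h j
    specialize h' j
    simp only [embInf_apply, Fin.ext_iff, Fin.coe_min] at h h' ⊢
    rcases h with h | ⟨h0, h1, h2⟩ <;> rcases h' with h' | ⟨h0', h1', h2'⟩
    · omega
    · by_cases hc : (S j : ℕ) < S' j
      · omega
      · right
        exact ⟨h0', by omega⟩
    · by_cases hc : (S' j : ℕ) < S j
      · omega
      · right
        exact ⟨h0, by omega⟩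
    · right
      exact ⟨h0, by omega⟩
  sup {p S T S' T'} h h' := by
    rw [(minor_elemL hi hq _ _).2] at h h' ⊢
    intro j
    specialize h j
    specialize h' j
    simp only [embSup_apply, Fin.ext_iff, Fin.coe_max] at h h' ⊢
    rcases h with h | ⟨h0, h1, h2⟩ <;> rcases h' with h' | ⟨h0', h1', h2'⟩
    · omega
    · by_cases hc : (S j : ℕ) + 1 < i
      · right
        exact ⟨h0', by omega⟩
      · omega
    · by_cases hc : (S' j : ℕ) + 1 < i
      · right
        exact ⟨h0, by omega⟩
      · omega
    · right
      exact ⟨h0, by omega⟩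

/-! ### The triangular factors. -/

/-- Networks all of whose positive minors have a column set below the row set. -/
def loweringNetworks (n : ℕ) : Submonoid (Matrix (Fin n) (Fin n) ℝ) where
  carrier := {M | IsNetwork M ∧
    ∀ (p : ℕ) (S T : Fin p ↪o Fin n), 0 < minor M S T → ∀ j, T j ≤ S j}
  one_mem' := ⟨isNetwork_one, fun p S T h j => by
    rw [← diagonal_one, minor_diagonal_pos_iff fun _ => one_pos] at h
    rw [h]⟩
  mul_mem' := fun {M N} hM hN => ⟨hM.1.mul hN.1, fun p S T h j => by
    obtain ⟨U, h1, h2⟩ := (hM.1.tn.minor_mul_pos hN.1.tn).1 h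
    exact (hN.2 p U T h2 j).trans (hM.2 p S U h1 j)⟩

lemma elemL_mem_loweringNetworks {i : ℕ} (hi : 2 ≤ i) {q : ℝ} (hq : 0 ≤ q) :
    elemL n i q ∈ loweringNetworks n := by
  refine ⟨isNetwork_elemL hi hq, fun p S T h j => ?_⟩
  rcases (minor_elemL hi hq S T).2.1 h j with h | ⟨-, h1, h2⟩
  · exact h.le
  · rw [Fin.le_def]
    omega

lemma lowerFactor_mem_loweringNetworks {l : ℕ → ℕ → ℝ}
    (hl : ∀ i j : ℕ, 2 ≤ i → 1 ≤ j → i + j ≤ n + 1 → 0 ≤ l i j) :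
    lowerFactor n l ∈ loweringNetworks n := by
  refine Submonoid.list_prod_mem _ fun M hM => ?_
  obtain ⟨i, hi, rfl⟩ := List.mem_map.1 hM
  rw [List.mem_range'_1] at hi
  refine Submonoid.list_prod_mem _ fun M hM => ?_
  obtain ⟨j, hj, rfl⟩ := List.mem_map.1 hM
  rw [List.mem_reverse, List.mem_range'_1] at hj
  exact elemL_mem_loweringNetworks (by omega) (hl _ _ (by omega) (by omega) (by omega))

lemma upperFactor_transpose_mem_loweringNetworks {u : ℕ → ℕ → ℝ}
    (hu : ∀ i j : ℕ, 2 ≤ i → 1 ≤ j → i + j ≤ n + 1 → 0 ≤ u i j) :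
    (upperFactor n u)ᵀ ∈ loweringNetworks n := by
  rw [upperFactor, transpose_list_prod]
  refine Submonoid.list_prod_mem _ fun M hM => ?_
  rw [List.mem_reverse, List.mem_map] at hM
  obtain ⟨_, hM, rfl⟩ := hM
  obtain ⟨i, hi, rfl⟩ := List.mem_map.1 hM
  rw [List.mem_reverse, List.mem_range'_1] at hi
  rw [matQ, transpose_list_prod]
  refine Submonoid.list_prod_mem _ fun M hM => ?_
  rw [List.mem_reverse, List.mem_map] at hM
  obtain ⟨_, hM, rfl⟩ := hM
  obtain ⟨j, hj, rfl⟩ := List.mem_map.1 hM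
  rw [List.mem_range'_1] at hj
  rw [elemU, transpose_transpose]
  exact elemL_mem_loweringNetworks (by omega) (hu _ _ (by omega) (by omega) (by omega))

/-! ### Comparison of reachability. -/

/-- `N` reaches from every lower row set a column set at least as low as any that `M` reaches. -/
def ReachesLower (M N : Matrix (Fin n) (Fin n) ℝ) : Prop :=
  ∀ (p : ℕ) (S S' T : Fin p ↪o Fin n), (∀ j, S' j ≤ S j) → 0 < minor M S T →
    ∃ T' : Fin p ↪o Fin n, (∀ j, T' j ≤ T j) ∧ 0 < minor N S' T'

/-- The meet of `S' → S'` with `S → T` starts at `S'` and ends below `T`. -/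
lemma IsNetwork.reachesLower_self {M : Matrix (Fin n) (Fin n) ℝ} (hM : IsNetwork M) :
    ReachesLower M M := fun p S S' T hS h =>
  ⟨embInf S' T, fun j => inf_le_right, by
    simpa only [embInf_eq_left hS] using hM.inf (hM.principal S') h⟩

lemma ReachesLower.mul {M N M' N' : Matrix (Fin n) (Fin n) ℝ} (hM : IsTN M) (hN : IsTN N)
    (hM' : IsTN M') (hN' : IsTN N') (h : ReachesLower M M') (h' : ReachesLower N N') :
    ReachesLower (M * N) (M' * N') := by
  intro p S S' T hS hpos
  obtain ⟨U, h1, h2⟩ := (hM.minor_mul_pos hN).1 hpos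
  obtain ⟨U', hU, h1'⟩ := h p S S' U hS h1
  obtain ⟨T', hT, h2'⟩ := h' p U U' T hU h2
  exact ⟨T', hT, (hM'.minor_mul_pos hN').2 ⟨U', h1', h2'⟩⟩

lemma isNetwork_pow {M : Matrix (Fin n) (Fin n) ℝ} (hM : IsNetwork M) (k : ℕ) :
    IsNetwork (M ^ k) := by
  induction k with
  | zero => exact (pow_zero M).symm ▸ isNetwork_one
  | succ k ih => exact (pow_succ M k).symm ▸ ih.mul hM

lemma ReachesLower.pow {M N : Matrix (Fin n) (Fin n) ℝ} (hM : IsNetwork M) (hN : IsNetwork N)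
    (h : ReachesLower M N) (k : ℕ) : ReachesLower (M ^ k) (N ^ k) := by
  induction k with
  | zero =>
    simp only [pow_zero]
    exact isNetwork_one.reachesLower_self
  | succ k ih =>
    simp only [pow_succ]
    exact ih.mul (isNetwork_pow hM k).tn hM.tn (isNetwork_pow hN k).tn hN.tn h

/-! ### Corner minors and total positivity. -/

/-- The increasing enumeration of the first `c` indices. -/
def firstEmb (c : ℕ) (hc : c ≤ n) : Fin c ↪o Fin n :=
  OrderEmbedding.ofStrictMono (firstIdx c hc) fun _ _ h => h

/-- The increasing enumeration of the last `c` indices. -/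
def lastEmb (c : ℕ) (hc : c ≤ n) : Fin c ↪o Fin n :=
  OrderEmbedding.ofStrictMono (lastIdx c hc) fun _ _ h => Nat.add_lt_add_left h _

lemma lowerLeftMinor_eq_minor (M : Matrix (Fin n) (Fin n) ℝ) (c : ℕ) (hc : c ≤ n) :
    lowerLeftMinor M c hc = minor M (lastEmb c hc) (firstEmb c hc) := rfl

lemma upperRightMinor_eq_minor (M : Matrix (Fin n) (Fin n) ℝ) (c : ℕ) (hc : c ≤ n) :
    upperRightMinor M c hc = minor M (firstEmb c hc) (lastEmb c hc) := rfl

lemma firstEmb_le {c : ℕ} (hc : c ≤ n) (S : Fin c ↪o Fin n) (j : Fin c) :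
    firstEmb c hc j ≤ S j := by
  have key : ∀ (k : ℕ) (hk : k < c), k ≤ (S ⟨k, hk⟩ : ℕ) := by
    intro k
    induction k with
    | zero => exact fun _ => Nat.zero_le _
    | succ k ih =>
      intro hk
      have h1 : S ⟨k, by omega⟩ < S ⟨k + 1, hk⟩ := S.strictMono (Nat.lt_succ_self k)
      exact (ih (by omega)).trans_lt h1
  exact key j j.isLt

lemma le_lastEmb {c : ℕ} (hc : c ≤ n) (S : Fin c ↪o Fin n) (j : Fin c) :
    S j ≤ lastEmb c hc j := by
  -- Here `m` counts the entries of `S` after position `k`.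
  have key : ∀ (m k : ℕ) (hk : k < c), k + m + 1 = c → (S ⟨k, hk⟩ : ℕ) + m + 1 ≤ n := by
    intro m
    induction m with
    | zero => exact fun k hk _ => (S ⟨k, hk⟩).isLt
    | succ m ih =>
      intro k hk hm
      have h1 : S ⟨k, hk⟩ < S ⟨k + 1, by omega⟩ := S.strictMono (Nat.lt_succ_self k)
      have h2 := ih (k + 1) (by omega) (by omega)
      rw [Fin.lt_def] at h1
      omega
  have := key (c - 1 - j) j j.isLt (by have := j.isLt; omega)
  change (S j : ℕ) ≤ n - c + j
  have := j.isLt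
  simp only [Fin.eta] at *
  omega

lemma ReachesLower.lowerLeftMinor_pos {M N : Matrix (Fin n) (Fin n) ℝ} (h : ReachesLower M N)
    {c : ℕ} {hc : c ≤ n} (hM : 0 < lowerLeftMinor M c hc) : 0 < lowerLeftMinor N c hc := by
  obtain ⟨T', hT, hpos⟩ := h c (lastEmb c hc) (lastEmb c hc) (firstEmb c hc)
    (fun _ => le_rfl) hM
  have : T' = firstEmb c hc := DFunLike.ext _ _ fun j => (hT j).antisymm (firstEmb_le hc T' j)
  rwa [this] at hpos

/-- A network is TP as soon as its proper corner minors are positive. -/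
lemma IsNetwork.isTP {M : Matrix (Fin n) (Fin n) ℝ} (hM : IsNetwork M)
    (hl : ∀ (c : ℕ) (hc : c < n), 0 < c → 0 < lowerLeftMinor M c hc.le)
    (hu : ∀ (c : ℕ) (hc : c < n), 0 < c → 0 < upperRightMinor M c hc.le) : IsTP M := by
  intro p S T
  change 0 < minor M S T
  have hp : p ≤ n := by simpa using Fintype.card_le_of_injective S S.injective
  have hdiag : ∀ S' T' : Fin p ↪o Fin n, S' = T' → 0 < minor M S' T' := by
    rintro S' _ rfl
    exact hM.principal S'
  have hlast : p = 0 ∨ p = n ∨ (0 < p ∧ p < n) := by omega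
  -- The corner hypotheses omit sizes `0` and `n`, where there is only one index set and every minor
  -- is principal.
  have hfl : (p = 0 ∨ p = n) → ∀ S' T' : Fin p ↪o Fin n, S' = T' := by
    intro h S' T'
    have hS : ∀ S' : Fin p ↪o Fin n, S' = firstEmb p hp := fun S' => by
      refine DFunLike.ext _ _ fun j => le_antisymm ((le_lastEmb hp S' j).trans ?_)
        (firstEmb_le hp S' j)
      change n - p + j ≤ j
      have := j.isLt
      omega
    rw [hS S', hS T']
  have hlow : 0 < minor M (lastEmb p hp) (firstEmb p hp) := by
    rcases hlast with h | h | h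
    · exact hdiag _ _ (hfl (Or.inl h) _ _)
    · exact hdiag _ _ (hfl (Or.inr h) _ _)
    · exact hl p h.2 h.1
  have hupp : 0 < minor M (firstEmb p hp) (lastEmb p hp) := by
    rcases hlast with h | h | h
    · exact hdiag _ _ (hfl (Or.inl h) _ _)
    · exact hdiag _ _ (hfl (Or.inr h) _ _)
    · exact hu p h.2 h.1
  -- The joins give `S → last` and `last → T`; their meet is `S → T`.
  have h1 := hM.sup hupp (hM.principal S)
  rw [embSup_eq_right (firstEmb_le hp S), embSup_eq_left (le_lastEmb hp S)] at h1
  have h2 := hM.sup hlow (hM.principal T)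
  rw [embSup_eq_left (le_lastEmb hp T), embSup_eq_right (firstEmb_le hp T)] at h2
  simpa only [embInf_eq_left (le_lastEmb hp S), embInf_eq_right (le_lastEmb hp T)] using
    hM.inf h1 h2

/-! ### Corner minors of powers of `L D V`. -/

section Factorization

variable {L V : Matrix (Fin n) (Fin n) ℝ} {d : Fin n → ℝ}

lemma isNetwork_ldu (hL : L ∈ loweringNetworks n) (hd : ∀ a, 0 < d a)
    (hV : Vᵀ ∈ loweringNetworks n) : IsNetwork (L * diagonal d * V) := by
  have := hV.1.transpose
  rw [transpose_transpose] at this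
  exact (hL.1.mul (isNetwork_diagonal hd)).mul this

/-- The lower-left corner minors of powers of `L D V` are positive exactly when those of the
powers of the lower factor `L` are. -/
lemma lowerPowers_ldu (hL : L ∈ loweringNetworks n) (hd : ∀ a, 0 < d a)
    (hV : Vᵀ ∈ loweringNetworks n) : lowerPowers (L * diagonal d * V) = lowerPowers L := by
  have hD := isNetwork_diagonal hd
  have hV' : IsNetwork V := by simpa using hV.1.transpose
  have hA := isNetwork_ldu hL hd hV
  have hone : IsNetwork (1 : Matrix (Fin n) (Fin n) ℝ) := isNetwork_one
  -- Any network may stay put, and raising indices never beats staying put; so `D` and `V` can be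
  -- exchanged with `1`.
  have hinto : ∀ {M : Matrix (Fin n) (Fin n) ℝ}, IsNetwork M → ReachesLower 1 M :=
    fun hM p S S' T hS h => by
      rw [← diagonal_one, minor_diagonal_pos_iff fun _ => one_pos] at h
      exact ⟨S', h ▸ hS, hM.principal S'⟩
  have hfrom : ∀ {M : Matrix (Fin n) (Fin n) ℝ},
      (∀ (p : ℕ) (S T : Fin p ↪o Fin n), 0 < minor M S T → ∀ j, S j ≤ T j) → ReachesLower M 1 :=
    fun hM p S S' T hS h => ⟨S', fun j => (hS j).trans (hM p S T h j), hone.principal S'⟩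
  have hVup : ReachesLower V 1 := hfrom fun p S T h => hV.2 p T S (by rwa [minor_transpose])
  have hDup : ReachesLower (diagonal d) 1 := hfrom fun p S T h j => by
    rw [(minor_diagonal_pos_iff hd S T).1 h]
  have hAL : ReachesLower (L * diagonal d * V) L := by
    have := (hL.1.reachesLower_self.mul hL.1.tn hD.tn hL.1.tn hone.tn hDup).mul
      (hL.1.mul hD).tn hV'.tn (hL.1.mul hone).tn hone.tn hVup
    simpa only [mul_one] using this
  have hLA : ReachesLower L (L * diagonal d * V) := by
    have := (hL.1.reachesLower_self.mul hL.1.tn hone.tn hL.1.tn hD.tn (hinto hD)).mul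
      (hL.1.mul hone).tn hone.tn (hL.1.mul hD).tn hV'.tn (hinto hV')
    simpa only [mul_one] using this
  ext w
  exact ⟨fun h => ⟨h.1, fun c hc h0 => (hAL.pow hA hL.1 w).lowerLeftMinor_pos (h.2 c hc h0)⟩,
    fun h => ⟨h.1, fun c hc h0 => (hLA.pow hL.1 hA w).lowerLeftMinor_pos (h.2 c hc h0)⟩⟩

lemma upperPowers_eq_lowerPowers_transpose (M : Matrix (Fin n) (Fin n) ℝ) :
    upperPowers M = lowerPowers Mᵀ := by
  simp only [upperPowers, lowerPowers, ← transpose_pow, upperRightMinor_eq_minor,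
    lowerLeftMinor_eq_minor, minor_transpose]

/-- Transposition preserves the shape `L D V` and swaps the roles of `L` and `V`. -/
lemma upperPowers_ldu (hL : L ∈ loweringNetworks n) (hd : ∀ a, 0 < d a)
    (hV : Vᵀ ∈ loweringNetworks n) : upperPowers (L * diagonal d * V) = upperPowers V := by
  rw [upperPowers_eq_lowerPowers_transpose, upperPowers_eq_lowerPowers_transpose, transpose_mul,
    transpose_mul, diagonal_transpose, ← mul_assoc]
  exact lowerPowers_ldu hV hd (by rwa [transpose_transpose])

end Factorization

/-! ### Exponents as least elements of upward closed sets. -/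

lemma IsNetwork.tpPowers_eq {M : Matrix (Fin n) (Fin n) ℝ} (hM : IsNetwork M) :
    tpPowers M = lowerPowers M ∩ upperPowers M := by
  ext k
  refine ⟨fun h => ⟨⟨h.1, fun c hc _ => h.2 c (lastEmb c hc.le) (firstEmb c hc.le)⟩,
    ⟨h.1, fun c hc _ => h.2 c (firstEmb c hc.le) (lastEmb c hc.le)⟩⟩,
    fun h => ⟨h.1.1, (isNetwork_pow hM k).isTP h.1.2 h.2.2⟩⟩

/-- Each additional factor can be idle once the lowest set is reached. -/
lemma IsNetwork.mem_lowerPowers_of_le {M : Matrix (Fin n) (Fin n) ℝ} (hM : IsNetwork M) {k m : ℕ}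
    (hkm : k ≤ m) (hk : k ∈ lowerPowers M) : m ∈ lowerPowers M := by
  induction m, hkm using Nat.le_induction with
  | base => exact hk
  | succ m _ ih =>
    refine ⟨Nat.succ_pos m, fun c hc h0 => ?_⟩
    rw [pow_succ, lowerLeftMinor_eq_minor]
    exact ((isNetwork_pow hM m).tn.minor_mul_pos hM.tn).2 ⟨firstEmb c hc.le, ih.2 c hc h0, hM.principal _⟩

/-- Nonemptiness matters because `sInf ∅ = 0` in `ℕ`. -/
lemma sInf_inter_eq_max {X Y : Set ℕ} (hX : ∀ {k m}, k ≤ m → k ∈ X → m ∈ X)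
    (hY : ∀ {k m}, k ≤ m → k ∈ Y → m ∈ Y) (h : (X ∩ Y).Nonempty) :
    sInf (X ∩ Y) = max (sInf X) (sInf Y) := by
  refine le_antisymm (Nat.sInf_le ⟨?_, ?_⟩) (max_le ?_ ?_)
  · exact hX (le_max_left _ _) (Nat.sInf_mem h.left)
  · exact hY (le_max_right _ _) (Nat.sInf_mem h.right)
  · exact Nat.sInf_le (Nat.sInf_mem h).1
  · exact Nat.sInf_le (Nat.sInf_mem h).2

end OscMat

theorem theorem2 {n : ℕ} (hn : 2 ≤ n) (A : Matrix (Fin n) (Fin n) ℝ)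
    (hA : OscMat.IsOscillatory A)
    (l : ℕ → ℕ → ℝ) (d : Fin n → ℝ) (u : ℕ → ℕ → ℝ)
    (hSEB : OscMat.IsSEBFactorization A l d u) :
    (OscMat.tpPowers A).Nonempty ∧
    (OscMat.lowerPowers (OscMat.lowerFactor n l)).Nonempty ∧
    (OscMat.upperPowers (OscMat.upperFactor n u)).Nonempty ∧
    OscMat.exponent A =
      max (OscMat.lowerExponent (OscMat.lowerFactor n l))
        (OscMat.upperExponent (OscMat.upperFactor n u)) := by
  have hL := OscMat.lowerFactor_mem_loweringNetworks hSEB.l_nonneg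
  have hV := OscMat.upperFactor_transpose_mem_loweringNetworks hSEB.u_nonneg
  have hM : OscMat.IsNetwork A := hSEB.eq_prod ▸ OscMat.isNetwork_ldu hL hSEB.d_pos hV
  have htp : OscMat.tpPowers A = OscMat.lowerPowers (OscMat.lowerFactor n l) ∩
      OscMat.upperPowers (OscMat.upperFactor n u) := by
    rw [hM.tpPowers_eq, hSEB.eq_prod, OscMat.lowerPowers_ldu hL hSEB.d_pos hV,
      OscMat.upperPowers_ldu hL hSEB.d_pos hV]
  have hne : (OscMat.tpPowers A).Nonempty := hA.2
  refine ⟨hne, (htp ▸ hne).left, (htp ▸ hne).right, ?_⟩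
  rw [OscMat.exponent, htp]
  refine OscMat.sInf_inter_eq_max (fun h => hL.1.mem_lowerPowers_of_le h) (fun h => ?_) (htp ▸ hne)
  rw [OscMat.upperPowers_eq_lowerPowers_transpose]
  exact hV.1.mem_lowerPowers_of_le h
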